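/- Let $\mathcal C=[-1,1]^n\subset\mathbb R^n$, let $S\subset\mathcal C$ be Borel measurable and countably $1$-rectifiable (that is, $S=\bigcup_{i}f_i(A_i)$ for countably many bounded sets $A_i\subset\mathbb R$ and Lipschitz maps $f_i:A_i\to\mathbb R^n$), let $a\in[0,\infty]$ and let $b:S\to[0,a]$ be lower semi-continuous. Extend $b$ to $\mathcal C\setminus S$ by the value $a$, and for $\lambda\geq 0$ put $S_\lambda=\{z\in S \mid b(z)\leq\lambda\}$. Assume that $\mathcal H^1(S_\lambda)<\infty$ for all $\lambda\in[0,a)$, where $\mathcal H^1$ is the one-dimensional Hausdorff measure. For $x,y\in\mathcal C$ let $\Gamma^{xy}$ be the set of all Lipschitz paths $\gamma:[0,1]\to\mathcal C$ with $\gamma(0)=x$ and $\gamma(1)=y$. For $\gamma\in\Gamma^{xy}$ let $$L(\gamma)=\int_0^1 b(\gamma(t))\,|\dot\gamma(t)|\,\mathrm dt,\qquad \operatorname{len}(\gamma)=\int_0^1|\dot\gamma(t)|\,\mathrm dt,$$ with the convention $\infty\cdot 0=0$, and let $$d(x,y)=\inf_{\gamma\in\Gamma^{xy}}\int_{\gamma([0,1])}b\,\mathrm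 d\mathcal H^1 .$$ Proposition (existence and arc length of a minimizer for $d(x,y)$). Let $x,y\in\mathcal C$ with $d(x,y)<\infty$. Then there is $\psi\in\Gamma^{xy}$ with $L(\psi)=d(x,y)=\min_{\gamma\in\Gamma^{xy}}L(\gamma)$ that has the following properties. 1. If $x\neq y$, then $\psi$ is injective. 2. If $a=\infty$, then $\operatorname{len}(\psi)\leq\mathcal H^1(S_1)+d(x,y)$. 3. If $0<a<\infty$, then $\operatorname{len}(\psi)\leq\mathcal H^1(S_{a/2})+\frac2a\,d(x,y)$. -/

import Mathlib

open Set MeasureTheory Measure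
open scoped ENNReal NNReal

noncomputable section

namespace UrbanMetric

/-- The hypercube `[-1,1]^n` in Euclidean `n`-space. -/
def cube (n : ℕ) : Set (EuclideanSpace ℝ (Fin n)) :=
  {x | ∀ i, x i ∈ Icc (-1 : ℝ) 1}

/-- A set is countably `1`-rectifiable if it is a countable union of Lipschitz images of bounded
subsets of the real line. -/
def CountablyOneRectifiable {n : ℕ} (S : Set (EuclideanSpace ℝ (Fin n))) : Prop :=
  ∃ (A : ℕ → Set ℝ) (f : ℕ → ℝ → EuclideanSpace ℝ (Fin n)),
    (∀ i, Bornology.IsBounded (A i)) ∧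
    (∀ i, ∃ K : ℝ≥0, LipschitzOnWith K (f i) (A i)) ∧
    S = ⋃ i, f i '' A i

/-- The Lipschitz paths `[0,1] → [-1,1]^n` from `x` to `y`. A path is represented by a function on
`ℝ`, of which only the restriction to `[0,1]` matters. -/
def paths {n : ℕ} (x y : EuclideanSpace ℝ (Fin n)) : Set (ℝ → EuclideanSpace ℝ (Fin n)) :=
  {γ | (∃ K : ℝ≥0, LipschitzOnWith K γ (Icc 0 1)) ∧ MapsTo γ (Icc 0 1) (cube n) ∧
    γ 0 = x ∧ γ 1 = y}

open Classical in
/-- The friction coefficient `b` on `S`, extended by the value `a` outside of `S`. -/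
def friction {n : ℕ} (S : Set (EuclideanSpace ℝ (Fin n))) (a : ℝ≥0∞) (b : S → ℝ≥0∞)
    (z : EuclideanSpace ℝ (Fin n)) : ℝ≥0∞ :=
  if h : z ∈ S then b ⟨z, h⟩ else a

/-- The part `S_l` of the network `S` on which the friction coefficient is at most `l`. -/
def sublevel {n : ℕ} (S : Set (EuclideanSpace ℝ (Fin n))) (b : S → ℝ≥0∞) (l : ℝ≥0∞) :
    Set (EuclideanSpace ℝ (Fin n)) :=
  {z | ∃ h : z ∈ S, b ⟨z, h⟩ ≤ l}

/-- The generalized urban metric: the infimum, over all Lipschitz paths from `x` to `y`, of the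
integral of the extended friction coefficient over the image of the path with respect to the
one-dimensional Hausdorff measure. -/
def urbanDist {n : ℕ} (S : Set (EuclideanSpace ℝ (Fin n))) (a : ℝ≥0∞) (b : S → ℝ≥0∞)
    (x y : EuclideanSpace ℝ (Fin n)) : ℝ≥0∞ :=
  ⨅ γ ∈ paths x y, ∫⁻ z in γ '' Icc 0 1, friction S a b z ∂μH[1]

/-- The path length `∫ b(γ) |γ'|` over `[0,1]`, with multiplicity (and `∞ · 0 = 0`). The derivative
at the two end points is irrelevant, since they form a null set. -/
def pathLength {n : ℕ} (S : Set (EuclideanSpace ℝ (Fin n))) (a : ℝ≥0∞) (b : S → ℝ≥0∞)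
    (γ : ℝ → EuclideanSpace ℝ (Fin n)) : ℝ≥0∞ :=
  ∫⁻ t in Icc (0 : ℝ) 1, friction S a b (γ t) * ‖deriv γ t‖ₑ

/-- The Euclidean arc length `∫ |γ'|` over `[0,1]`. -/
def arcLength {n : ℕ} (γ : ℝ → EuclideanSpace ℝ (Fin n)) : ℝ≥0∞ :=
  ∫⁻ t in Icc (0 : ℝ) 1, ‖deriv γ t‖ₑ

end UrbanMetric

end

/-! The proof is the direct method, applied to the image functional `∫ b dμH[1]` instead of to `L`.
The image of a path between distinct points contains an injective arc of constant speed
(`exists_arc`), and passing to it does not raise the cost. Along a minimizing sequence of such arcs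
the lengths are bounded: off `S_r`, with `0 < r < a`, the friction exceeds `r`, so the length is at
most `μH[1] (S_r)` plus cost over `r` (`hausdorffMeasure_image_le_add`). Arzelà–Ascoli gives a limit
path.

The cost is lower semicontinuous along the sequence (`setLIntegral_image_le_liminf`): by layer cake
it suffices to treat superlevel sets of the friction. Their complements have finite measure, hence
are nearly exhausted by closed sets, and for open sets the claim is Fatou's lemma in the time
variable. Lower semicontinuity of `b` enters only as Borel measurability.

An arc `ψ` in the image of the limit path is then the minimizer. An image integral never exceeds the
path length (`setLIntegral_image_le`), and for a constant-speed arc the converse holds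
(`pathLength_le`), so `L(ψ) = d(x,y)` is minimal. The length bounds are the estimate above with `r =
1` or `r = a / 2`. -/

namespace UrbanMetric

open Filter Topology

/-! ### Lipschitz paths in metric spaces: compactness and removal of loops. -/

section Metric

variable {X : Type*} [MetricSpace X]

/-- The one-dimensional Hausdorff measure of a connected set is at least its diameter. -/
theorem edist_le_hausdorffMeasure_of_isPreconnected [MeasurableSpace X] [BorelSpace X]
    {A : Set X} (hA : IsPreconnected A) {x y : X} (hx : x ∈ A) (hy : y ∈ A) :
    edist x y ≤ μH[1] A := by
  -- The distance to `x` does not increase `μH[1]`, and by connectedness it maps `A` onto a set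
  -- containing a whole interval.
  have hl : LipschitzWith 1 (fun z => dist z x) := LipschitzWith.dist_left x
  have hc : IsPreconnected ((fun z => dist z x) '' A) := hA.image _ hl.continuous.continuousOn
  have hsub : Icc 0 (dist y x) ⊆ (fun z => dist z x) '' A :=
    hc.Icc_subset ⟨x, hx, dist_self x⟩ ⟨y, hy, rfl⟩
  calc edist x y = μH[1] (Icc 0 (dist y x)) := by
        rw [hausdorffMeasure_real, Real.volume_Icc, sub_zero, edist_comm, edist_dist]
    _ ≤ μH[1] ((fun z => dist z x) '' A) := measure_mono hsub
    _ ≤ μH[1] A := by simpa using hl.hausdorffMeasure_image_le zero_le_one A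

/-- Arzelà–Ascoli for Lipschitz paths in a compact set. -/
theorem exists_subseq_tendsto_of_lipschitzOnWith {K : Set X} (hK : IsCompact K) {L : ℝ≥0}
    {γ : ℕ → ℝ → X} (hγ : ∀ k, LipschitzOnWith L (γ k) (Icc 0 1))
    (hmaps : ∀ k, MapsTo (γ k) (Icc 0 1) K) :
    ∃ (g : ℝ → X) (φ : ℕ → ℕ), StrictMono φ ∧ MapsTo g (Icc 0 1) K ∧
      ∀ t ∈ Icc (0 : ℝ) 1, Tendsto (fun k => γ (φ k) t) atTop (𝓝 (g t)) := by
  let A : Set (BoundedContinuousFunction (Icc (0 : ℝ) 1) X) :=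
    {f | LipschitzWith L f ∧ ∀ t, f t ∈ K}
  have hev : ∀ t : Icc (0 : ℝ) 1,
      Continuous fun f : BoundedContinuousFunction (Icc (0 : ℝ) 1) X => f t :=
    fun t => continuous_eval_const t
  have hA : IsCompact A := by
    refine BoundedContinuousFunction.arzela_ascoli₂ K hK A ?_ (fun f t hf => hf.2 t) ?_
    · have : A = (⋂ s, ⋂ t, {f : BoundedContinuousFunction (Icc (0 : ℝ) 1) X |
          dist (f s) (f t) ≤ L * dist s t}) ∩ ⋂ t, {f | f t ∈ K} := by
        ext f
        simp only [A, lipschitzWith_iff_dist_le_mul, mem_inter_iff, mem_iInter, mem_ofPred_eq]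
      rw [this]
      refine (isClosed_iInter fun s => isClosed_iInter fun t => ?_).inter
        (isClosed_iInter fun t => hK.isClosed.preimage (hev t))
      exact isClosed_le ((hev s).dist (hev t)) continuous_const
    · exact (LipschitzWith.uniformEquicontinuous _ L fun f => f.2.1).equicontinuous
  let F : ℕ → BoundedContinuousFunction (Icc (0 : ℝ) 1) X := fun k =>
    BoundedContinuousFunction.mkOfCompact
      ⟨(Icc 0 1).domRestrict (γ k), (hγ k).continuousOn.domRestrict⟩
  have hF : ∀ k, F k ∈ A := fun k => ⟨(hγ k).to_restrict, fun t => hmaps k t.2⟩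
  obtain ⟨f, hf, φ, hφ, hlim⟩ := hA.tendsto_subseq hF
  refine ⟨IccExtend zero_le_one f, φ, hφ, fun t ht => ?_, fun t ht => ?_⟩
  · rw [IccExtend_of_mem _ _ ht]; exact hf.2 _
  · rw [IccExtend_of_mem _ _ ht]
    exact ((hev ⟨t, ht⟩).tendsto f).comp hlim

theorem lipschitzOnWith_of_tendsto {s : Set ℝ} {L : ℕ → ℝ≥0} {l : ℝ≥0} {γ : ℕ → ℝ → X}
    {g : ℝ → X} (hγ : ∀ k, LipschitzOnWith (L k) (γ k) s) (hL : Tendsto L atTop (𝓝 l))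
    (hlim : ∀ t ∈ s, Tendsto (fun k => γ k t) atTop (𝓝 (g t))) : LipschitzOnWith l g s := by
  refine LipschitzOnWith.of_dist_le_mul fun t ht u hu => ?_
  refine le_of_tendsto_of_tendsto ((hlim t ht).dist (hlim u hu))
    ((NNReal.tendsto_coe.2 hL).mul_const _) (Eventually.of_forall fun k => ?_)
  exact (hγ k).dist_le_mul t ht u hu

/-- Among the Lipschitz paths between two points in a compact set there is one with least
Lipschitz constant. -/
theorem exists_isLeast_lipschitz_constant {K : Set X} (hK : IsCompact K) {x y : X}
    {L₀ : ℝ≥0} {γ₀ : ℝ → X} (h₀ : LipschitzOnWith L₀ γ₀ (Icc 0 1))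
    (hm₀ : MapsTo γ₀ (Icc 0 1) K) (hx₀ : γ₀ 0 = x) (hy₀ : γ₀ 1 = y) :
    ∃ l : ℝ≥0, IsLeast {L : ℝ≥0 | ∃ γ : ℝ → X, LipschitzOnWith L γ (Icc 0 1) ∧
      MapsTo γ (Icc 0 1) K ∧ γ 0 = x ∧ γ 1 = y} l := by
  set A := {L : ℝ≥0 | ∃ γ : ℝ → X, LipschitzOnWith L γ (Icc 0 1) ∧
      MapsTo γ (Icc 0 1) K ∧ γ 0 = x ∧ γ 1 = y} with hAdef
  have hne : A.Nonempty := ⟨L₀, γ₀, h₀, hm₀, hx₀, hy₀⟩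
  obtain ⟨u, hu_anti, hu_lim, hu_mem⟩ := exists_seq_tendsto_sInf hne (OrderBot.bddBelow A)
  choose γ hγ hm hx hy using hu_mem
  -- The constants decrease, so `u 0` serves for compactness; the limit inherits the sharper
  -- constant `sInf A`.
  obtain ⟨g, φ, hφ, hg, hlim⟩ := exists_subseq_tendsto_of_lipschitzOnWith hK
    (L := u 0) (fun k => (hγ k).weaken (hu_anti (Nat.zero_le k))) hm
  refine ⟨sInf A, ⟨g, ?_, hg, ?_, ?_⟩, fun L hL => csInf_le (OrderBot.bddBelow A) hL⟩
  · exact lipschitzOnWith_of_tendsto (fun k => hγ (φ k)) (hu_lim.comp hφ.tendsto_atTop) hlim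
  · have := hlim 0 (by simp)
    simp only [hx] at this
    exact tendsto_nhds_unique this tendsto_const_nhds
  · have := hlim 1 (by simp)
    simp only [hy] at this
    exact tendsto_nhds_unique this tendsto_const_nhds

/-- Cutting out the loop of a path between the times `s < t` gives a path with a smaller Lipschitz
constant. -/
theorem exists_path_of_loop {l : ℝ≥0} {ψ : ℝ → X} (hψ : LipschitzOnWith l ψ (Icc 0 1))
    {s t : ℝ} (hs : s ∈ Icc (0 : ℝ) 1) (ht : t ∈ Icc (0 : ℝ) 1) (hst : s < t)
    (heq : ψ s = ψ t) :
    ∃ γ : ℝ → X, LipschitzOnWith (l * Real.toNNReal (1 - (t - s))) γ (Icc 0 1) ∧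
      MapsTo γ (Icc 0 1) (ψ '' Icc 0 1) ∧ γ 0 = ψ 0 ∧ γ 1 = ψ 1 := by
  set r : ℝ := 1 - (t - s) with hr
  have hr0 : 0 ≤ r := by rw [hr]; linarith [hs.1, ht.2]
  -- Time runs at speed `r` and jumps from `s` to `t`; `ψ` does not see the jump because `ψ s = ψ
  -- t`.
  let σ : ℝ → ℝ := fun u => if r * u ≤ s then r * u else r * u + (t - s)
  have hσ : ∀ u ∈ Icc (0 : ℝ) 1, σ u ∈ Icc (0 : ℝ) 1 := by
    intro u hu
    have h1 : 0 ≤ r * u := mul_nonneg hr0 hu.1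
    have h2 : r * u ≤ r := mul_le_of_le_one_right hr0 hu.2
    simp only [σ]
    split_ifs with h
    · exact ⟨h1, h.trans hs.2⟩
    · exact ⟨by linarith, by linarith⟩
  refine ⟨ψ ∘ σ, ?_, fun u hu => mem_image_of_mem ψ (hσ u hu), ?_, ?_⟩
  · have key : ∀ u ∈ Icc (0 : ℝ) 1, ∀ v ∈ Icc (0 : ℝ) 1, u ≤ v →
        dist (ψ (σ u)) (ψ (σ v)) ≤ l * (r * (v - u)) := by
      intro u hu v hv huv
      have hruv : r * u ≤ r * v := mul_le_mul_of_nonneg_left huv hr0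
      by_cases h1 : r * v ≤ s
      · have h2 : r * u ≤ s := hruv.trans h1
        have := hψ.dist_le_mul _ (hσ u hu) _ (hσ v hv)
        simp only [σ, h1, h2, if_true, Real.dist_eq] at this ⊢
        rw [abs_sub_comm, abs_of_nonneg (by linarith)] at this
        rwa [mul_sub]
      · by_cases h2 : r * u ≤ s
        · have e1 := hψ.dist_le_mul _ (hσ u hu) _ hs
          have e2 := hψ.dist_le_mul _ ht _ (hσ v hv)
          simp only [σ, h1, h2, if_true, if_false, Real.dist_eq] at e1 e2 ⊢
          rw [abs_sub_comm, abs_of_nonneg (by linarith)] at e1 e2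
          calc _ ≤ _ := dist_triangle _ (ψ s) _
            _ ≤ l * (s - r * u) + l * (r * v + (t - s) - t) := by
              refine add_le_add e1 ?_
              rw [heq]; exact e2
            _ = _ := by ring
        · have := hψ.dist_le_mul _ (hσ u hu) _ (hσ v hv)
          simp only [σ, h1, h2, if_false, Real.dist_eq] at this ⊢
          rw [abs_sub_comm, abs_of_nonneg (by linarith)] at this
          refine this.trans_eq ?_
          ring
    refine LipschitzOnWith.of_dist_le_mul fun u hu v hv => ?_
    rw [NNReal.coe_mul, Real.coe_toNNReal _ hr0, mul_assoc, Real.dist_eq]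
    rcases le_total u v with huv | huv
    · rw [abs_sub_comm, abs_of_nonneg (sub_nonneg.2 huv)]
      exact key u hu v hv huv
    · rw [dist_comm, abs_of_nonneg (sub_nonneg.2 huv)]
      exact key v hv u hu huv
  · have : σ 0 = 0 := by simp [σ, hs.1]
    simp [this]
  -- If `t = 1` the jump never happens and the new path ends at `ψ s`, which equals `ψ 1`.
  · by_cases h : r * 1 ≤ s
    · have h1 : t = 1 := le_antisymm ht.2 (by rw [hr] at h; linarith)
      have h2 : σ 1 = s := by simp only [σ, h, if_true]; rw [hr, h1]; ring
      simp [h2, heq, h1]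
    · have : σ 1 = 1 := by simp only [σ, h, if_false]; rw [hr]; ring
      simp [this]

end Metric

/-! ### Arcs of constant speed inside the image of a path. -/

section Arc

variable {X : Type*} [MetricSpace X] [MeasurableSpace X] [BorelSpace X]

theorem hausdorffMeasure_image_le_mul_volume {l : ℝ≥0} {ψ : ℝ → X} {s : Set ℝ}
    (hψ : LipschitzOnWith l ψ s) : μH[1] (ψ '' s) ≤ l * volume s := by
  simpa [hausdorffMeasure_real] using hψ.hausdorffMeasure_image_le zero_le_one

theorem hausdorffMeasure_image_Icc_le {l : ℝ≥0} {ψ : ℝ → X}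
    (hψ : LipschitzOnWith l ψ (Icc 0 1)) : μH[1] (ψ '' Icc 0 1) ≤ l := by
  simpa using hausdorffMeasure_image_le_mul_volume hψ

/-- An injective Lipschitz path can be reparametrized with Lipschitz constant the one-dimensional
Hausdorff measure of its image. -/
theorem exists_reparametrization {l : ℝ≥0} {ψ : ℝ → X} (hψ : LipschitzOnWith l ψ (Icc 0 1))
    (hinj : InjOn ψ (Icc 0 1)) :
    ∃ γ : ℝ → X, LipschitzOnWith (μH[1] (ψ '' Icc 0 1)).toNNReal γ (Icc 0 1) ∧
      MapsTo γ (Icc 0 1) (ψ '' Icc 0 1) ∧ γ 0 = ψ 0 ∧ γ 1 = ψ 1 := by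
  have hfin : ∀ s ⊆ Icc (0 : ℝ) 1, μH[1] (ψ '' s) ≠ ∞ := fun s hs =>
    ne_top_of_le_ne_top ENNReal.coe_ne_top
      ((measure_mono (image_mono hs)).trans (hausdorffMeasure_image_Icc_le hψ))
  have hsub : ∀ {s t : ℝ}, 0 ≤ s → t ≤ 1 → Icc s t ⊆ Icc (0 : ℝ) 1 := fun hs ht =>
    Icc_subset_Icc hs ht
  -- `G` is the arc length function; injectivity of `ψ` makes it additive over adjacent intervals.
  set G : ℝ → ℝ := fun t => (μH[1] (ψ '' Icc 0 t)).toReal with hG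
  have hnull : ∀ z : X, μH[1] ({z} : Set X) = 0 := fun z => by
    have : NullSingletonClass (μH[1] : Measure X) :=
      Measure.nullSingletonClass_hausdorff X zero_lt_one
    exact measure_singleton z
  have hadd : ∀ s t, 0 ≤ s → s ≤ t → t ≤ 1 →
      G t - G s = (μH[1] (ψ '' Icc s t)).toReal := by
    intro s t hs hst ht
    have hcomp : IsCompact (ψ '' Icc s t) :=
      isCompact_Icc.image_of_continuousOn (hψ.continuousOn.mono (hsub hs ht))
    have hdisj : AEDisjoint μH[1] (ψ '' Icc 0 s) (ψ '' Icc s t) := by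
      refine measure_mono_null (t := {ψ s}) ?_ (hnull _)
      rintro _ ⟨⟨u, hu, rfl⟩, ⟨v, hv, huv⟩⟩
      have : v = u := hinj ⟨hs.trans hv.1, hv.2.trans ht⟩ ⟨hu.1, hu.2.trans (hst.trans ht)⟩ huv
      have : u = s := le_antisymm hu.2 (this ▸ hv.1)
      rw [this]; rfl
    have : μH[1] (ψ '' Icc 0 t) = μH[1] (ψ '' Icc 0 s) + μH[1] (ψ '' Icc s t) := by
      rw [← measure_union₀ hcomp.measurableSet.nullMeasurableSet hdisj, ← image_union,
        Icc_union_Icc_eq_Icc hs hst]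
    simp only [hG]
    rw [this, ENNReal.toReal_add (hfin _ (hsub le_rfl (hst.trans ht))) (hfin _ (hsub hs ht))]
    ring
  have hdist : ∀ s t, 0 ≤ s → s ≤ t → t ≤ 1 → dist (ψ s) (ψ t) ≤ G t - G s := by
    intro s t hs hst ht
    rw [hadd s t hs hst ht, dist_edist]
    refine ENNReal.toReal_mono (hfin _ (hsub hs ht)) ?_
    exact edist_le_hausdorffMeasure_of_isPreconnected
      (isPreconnected_Icc.image _ (hψ.continuousOn.mono (hsub hs ht)))
      (mem_image_of_mem _ (left_mem_Icc.2 hst)) (mem_image_of_mem _ (right_mem_Icc.2 hst))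
  have hdist' : ∀ s ∈ Icc (0 : ℝ) 1, ∀ t ∈ Icc (0 : ℝ) 1, dist (ψ s) (ψ t) ≤ |G t - G s| := by
    intro s hs t ht
    rcases le_total s t with h | h
    · exact (hdist s t hs.1 h ht.2).trans (le_abs_self _)
    · rw [dist_comm, abs_sub_comm]
      exact (hdist t s ht.1 h hs.2).trans (le_abs_self _)
  have hGlip : LipschitzOnWith l G (Icc 0 1) := by
    have key : ∀ s t, 0 ≤ s → s ≤ t → t ≤ 1 → |G t - G s| ≤ l * |t - s| := by
      intro s t hs hst ht
      rw [hadd s t hs hst ht, abs_of_nonneg ENNReal.toReal_nonneg,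
        abs_of_nonneg (sub_nonneg.2 hst)]
      refine ENNReal.toReal_le_of_le_ofReal (by have := sub_nonneg.2 hst; positivity) ?_
      refine (hausdorffMeasure_image_le_mul_volume (hψ.mono (hsub hs ht))).trans_eq ?_
      rw [Real.volume_Icc, ENNReal.ofReal_mul l.coe_nonneg, ENNReal.ofReal_coe_nnreal]
    refine LipschitzOnWith.of_dist_le_mul fun s hs t ht => ?_
    rw [Real.dist_eq, Real.dist_eq]
    rcases le_total s t with h | h
    · rw [abs_sub_comm, abs_sub_comm s]; exact key s t hs.1 h ht.2
    · exact key t s ht.1 h hs.2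
  have hG0 : G 0 = 0 := by simp [hG, hnull]
  have hsurj : ∀ u ∈ Icc (0 : ℝ) 1, ∃ t ∈ Icc (0 : ℝ) 1, G t = u * G 1 := by
    intro u hu
    have h1 : 0 ≤ G 1 := ENNReal.toReal_nonneg
    have := intermediate_value_Icc zero_le_one hGlip.continuousOn
    rw [hG0] at this
    exact this ⟨mul_nonneg hu.1 h1, mul_le_of_le_one_left h1 hu.2⟩
  -- Any right inverse of `G / G 1` will do, even a discontinuous one: increments of `ψ` are bounded
  -- by those of `G`. For the same reason `ψ (σ 0) = ψ 0` and `ψ (σ 1) = ψ 1`.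
  choose! σ hσ hGσ using hsurj
  refine ⟨ψ ∘ σ, ?_, fun u hu => mem_image_of_mem ψ (hσ u hu), ?_, ?_⟩
  · refine LipschitzOnWith.of_dist_le_mul fun u hu v hv => ?_
    refine (hdist' _ (hσ u hu) _ (hσ v hv)).trans_eq ?_
    rw [hGσ u hu, hGσ v hv, ← sub_mul, abs_mul, Real.dist_eq, abs_sub_comm, mul_comm]
    congr 1
    exact abs_of_nonneg ENNReal.toReal_nonneg
  · have h0 : (0 : ℝ) ∈ Icc (0 : ℝ) 1 := by simp
    have := hdist' _ (hσ 0 h0) _ h0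
    rw [hGσ 0 h0, hG0] at this
    exact dist_le_zero.1 (by simpa using this)
  · have h1 : (1 : ℝ) ∈ Icc (0 : ℝ) 1 := by simp
    have := hdist' _ (hσ 1 h1) _ h1
    rw [hGσ 1 h1] at this
    exact dist_le_zero.1 (by simpa using this)

/-- The image of a Lipschitz path between distinct points contains an arc between these points,
parametrized proportionally to arc length. -/
theorem exists_arc {L : ℝ≥0} {γ : ℝ → X} (hγ : LipschitzOnWith L γ (Icc 0 1)) (hne : γ 0 ≠ γ 1) :
    ∃ (ψ : ℝ → X) (l : ℝ≥0), LipschitzOnWith l ψ (Icc 0 1) ∧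
      MapsTo ψ (Icc 0 1) (γ '' Icc 0 1) ∧ ψ 0 = γ 0 ∧ ψ 1 = γ 1 ∧ InjOn ψ (Icc 0 1) ∧
      μH[1] (ψ '' Icc 0 1) = l := by
  have hK : IsCompact (γ '' Icc 0 1) := isCompact_Icc.image_of_continuousOn hγ.continuousOn
  -- Minimize the Lipschitz constant among paths inside the image of `γ`. A loop could be cut out,
  -- and an arc shorter than `l` could be reparametrized, each contradicting minimality.
  obtain ⟨l, ⟨ψ, hψ, hm, h0, h1⟩, hmin⟩ :=
    exists_isLeast_lipschitz_constant hK hγ (mapsTo_image _ _) rfl rfl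
  have himg : ψ '' Icc 0 1 ⊆ γ '' Icc 0 1 := hm.image_subset
  have hl : 0 < l := by
    rcases eq_or_ne l 0 with rfl | h
    · refine absurd ?_ hne
      have := hψ.dist_le_mul 0 (by simp) 1 (by simp)
      rw [← h0, ← h1]
      exact dist_le_zero.1 (by simpa using this)
    · exact pos_iff_ne_zero.2 h
  have hloop : ∀ s ∈ Icc (0 : ℝ) 1, ∀ t ∈ Icc (0 : ℝ) 1, s < t → ψ s ≠ ψ t := by
    intro s hs t ht hst heq
    obtain ⟨g, hg, hgm, hg0, hg1⟩ := exists_path_of_loop hψ hs ht hst heq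
    have := hmin ⟨g, hg, hgm.mono_right himg, hg0.trans h0, hg1.trans h1⟩
    refine absurd this (not_le.2 (mul_lt_of_lt_one_right hl ?_))
    rw [Real.toNNReal_lt_one]
    linarith
  have hinj : InjOn ψ (Icc 0 1) := by
    intro s hs t ht heq
    rcases lt_trichotomy s t with h | h | h
    · exact absurd heq (hloop s hs t ht h)
    · exact h
    · exact absurd heq.symm (hloop t ht s hs h)
  refine ⟨ψ, l, hψ, hm, h0, h1, hinj, le_antisymm (hausdorffMeasure_image_Icc_le hψ) ?_⟩
  obtain ⟨g, hg, hgm, hg0, hg1⟩ := exists_reparametrization hψ hinj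
  have := hmin ⟨g, hg, hgm.mono_right himg, hg0.trans h0, hg1.trans h1⟩
  refine (ENNReal.coe_le_coe.2 this).trans ?_
  exact ENNReal.coe_toNNReal_le_self

/-- A path parametrized proportionally to arc length pushes the rescaled Lebesgue measure to the
Hausdorff measure of its image. -/
theorem hausdorffMeasure_restrict_image_eq_map {l : ℝ≥0} {ψ : ℝ → X}
    (hψ : LipschitzOnWith l ψ (Icc 0 1)) (hl : μH[1] (ψ '' Icc 0 1) = l) :
    μH[1].restrict (ψ '' Icc 0 1) = (l • volume.restrict (Icc (0 : ℝ) 1)).map ψ := by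
  have hae : AEMeasurable ψ (volume.restrict (Icc 0 1)) :=
    hψ.continuousOn.aemeasurable measurableSet_Icc
  have key : ∀ B : Set X, μH[1] (B ∩ ψ '' Icc 0 1) ≤ l * volume.restrict (Icc 0 1) (ψ ⁻¹' B) := by
    intro B
    rw [restrict_apply' measurableSet_Icc, inter_comm, ← image_inter_preimage, inter_comm]
    exact hausdorffMeasure_image_le_mul_volume (hψ.mono inter_subset_right)
  ext B hB
  rw [restrict_apply hB, map_apply_of_aemeasurable (hae.smul_measure _) hB, Measure.smul_apply,
    ENNReal.smul_def, smul_eq_mul]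
  -- Both measures have total mass `l`, so the inequality `key` for `Bᶜ` forces equality for `B`.
  refine le_antisymm (key B) ?_
  have h1 : (l : ℝ≥0∞) = μH[1] (B ∩ ψ '' Icc 0 1) + μH[1] (Bᶜ ∩ ψ '' Icc 0 1) := by
    rw [← hl, inter_comm, inter_comm Bᶜ, ← sdiff_eq, measure_inter_add_sdiff _ hB]
  have h2 : (l : ℝ≥0∞) = l * volume.restrict (Icc 0 1) (ψ ⁻¹' B) +
      l * volume.restrict (Icc 0 1) (ψ ⁻¹' Bᶜ) := by
    rw [← mul_add, preimage_compl, measure_add_measure_compl₀ (hae.nullMeasurable hB)]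
    simp
  have h3 : l * volume.restrict (Icc 0 1) (ψ ⁻¹' Bᶜ) ≠ ∞ :=
    ENNReal.mul_ne_top ENNReal.coe_ne_top (measure_ne_top _ _)
  refine (ENNReal.add_le_add_iff_right h3).1 ?_
  rw [← h2]
  nth_rewrite 1 [h1]
  gcongr
  exact key _

/-- This moves the cost of an arc to the fixed domain `[0,1]`, where Fatou's lemma and bounds on the
speed apply. -/
theorem setLIntegral_image_eq {l : ℝ≥0} {ψ : ℝ → X}
    (hψ : LipschitzOnWith l ψ (Icc 0 1)) (hl : μH[1] (ψ '' Icc 0 1) = l)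
    {f : X → ℝ≥0∞} (hf : Measurable f) :
    ∫⁻ z in ψ '' Icc 0 1, f z ∂μH[1] = l * ∫⁻ t in Icc (0 : ℝ) 1, f (ψ t) := by
  have hae : AEMeasurable ψ (volume.restrict (Icc 0 1)) :=
    hψ.continuousOn.aemeasurable measurableSet_Icc
  rw [hausdorffMeasure_restrict_image_eq_map hψ hl,
    lintegral_map' hf.aemeasurable (hae.smul_measure _), lintegral_smul_measure,
    ENNReal.smul_def, smul_eq_mul]

end Arc

/-! ### The inequality between image integrals and path lengths. -/

section AreaInequality

variable {E : Type*} [NormedAddCommGroup E] [InnerProductSpace ℝ E] [FiniteDimensional ℝ E]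

theorem intervalIntegrable_norm_deriv {L : ℝ≥0} {γ : ℝ → E} (hγ : LipschitzWith L γ) (s t : ℝ) :
    IntervalIntegrable (fun r => ‖deriv γ r‖) volume s t := by
  borelize E
  refine (intervalIntegrable_const (c := (L : ℝ))).mono_fun
    (measurable_deriv γ).norm.aestronglyMeasurable (Eventually.of_forall fun r => ?_)
  simpa using norm_deriv_le_of_lipschitz hγ

/-- Pairing `γ` with its increment `u` gives an absolutely continuous real function; integrate its
derivative, apply Cauchy–Schwarz and divide by `‖u‖`. -/
theorem norm_sub_le_integral_norm_deriv {L : ℝ≥0} {γ : ℝ → E} (hγ : LipschitzWith L γ) {s t : ℝ}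
    (hst : s ≤ t) : ‖γ t - γ s‖ ≤ ∫ r in s..t, ‖deriv γ r‖ := by
  set u := γ t - γ s with hu
  have hh : LipschitzWith (‖innerSL ℝ u‖₊ * L) fun r => innerSL ℝ u (γ r) :=
    (innerSL ℝ u).lipschitz.comp hγ
  have hint := (hh.lipschitzOnWith (s := uIcc s t)).absolutelyContinuousOnInterval
  have h1 : ‖u‖ * ‖u‖ = ∫ r in s..t, deriv (fun r => innerSL ℝ u (γ r)) r := by
    rw [hint.integral_deriv_eq_sub, ← map_sub, ← hu, innerSL_apply_apply,
      real_inner_self_eq_norm_mul_norm]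
  have h2 : ∫ r in s..t, deriv (fun r => innerSL ℝ u (γ r)) r ≤
      ∫ r in s..t, ‖u‖ * ‖deriv γ r‖ := by
    refine intervalIntegral.integral_mono_ae hst hint.intervalIntegrable_deriv
      ((intervalIntegrable_norm_deriv hγ s t).const_mul _) ?_
    filter_upwards [hγ.ae_differentiableAt_real] with r hr
    have : HasDerivAt (fun r => innerSL ℝ u (γ r)) (innerSL ℝ u (deriv γ r)) r :=
      (innerSL ℝ u).hasFDerivAt.comp_hasDerivAt r hr.hasDerivAt
    rw [this.deriv, innerSL_apply_apply]
    exact real_inner_le_norm _ _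
  rw [← h1, intervalIntegral.integral_const_mul] at h2
  rcases (norm_nonneg u).eq_or_lt with h | h
  · rw [← h]
    exact intervalIntegral.integral_nonneg hst fun r _ => norm_nonneg _
  · exact le_of_mul_le_mul_left h2 h

variable [MeasurableSpace E] [BorelSpace E]

/-- One-sided area formula for Lipschitz paths. -/
theorem hausdorffMeasure_image_le_lintegral {L : ℝ≥0} {γ : ℝ → E} (hγ : LipschitzWith L γ)
    {s : Set ℝ} (hs : MeasurableSet s) : μH[1] (γ '' s) ≤ ∫⁻ t in s, ‖deriv γ t‖ₑ := by
  have hii := intervalIntegrable_norm_deriv hγ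
  -- `γ` factors through the arc length `F` by a `1`-Lipschitz map, which reduces the claim to the
  -- area formula for the monotone real function `F`.
  set F : ℝ → ℝ := fun t => ∫ r in (0 : ℝ)..t, ‖deriv γ r‖ with hF
  have hsub : ∀ u v, F v - F u = ∫ r in u..v, ‖deriv γ r‖ := fun u v =>
    intervalIntegral.integral_interval_sub_left (hii _ _) (hii _ _)
  have hmono : Monotone F := fun u v huv => by
    rw [← sub_nonneg, hsub]
    exact intervalIntegral.integral_nonneg huv fun r _ => norm_nonneg _
  have hdist : ∀ u v, dist (γ u) (γ v) ≤ dist (F u) (F v) := by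
    have key : ∀ u v, u ≤ v → dist (γ u) (γ v) ≤ dist (F u) (F v) := fun u v huv => by
      rw [dist_comm, dist_comm (F u), Real.dist_eq, hsub, dist_eq_norm]
      exact (norm_sub_le_integral_norm_deriv hγ huv).trans (le_abs_self _)
    intro u v
    rcases le_total u v with h | h
    · exact key u v h
    · rw [dist_comm, dist_comm (F u)]; exact key v u h
  have hFlip : LipschitzWith L F := by
    refine LipschitzWith.of_dist_le_mul fun u v => ?_
    rw [Real.dist_eq, Real.dist_eq, hsub, ← Real.norm_eq_abs]
    refine intervalIntegral.norm_integral_le_of_norm_le_const fun r _ => ?_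
    rw [norm_norm]
    exact norm_deriv_le_of_lipschitz hγ
  have hle : ∀ A : Set ℝ, μH[1] (γ '' A) ≤ volume (F '' A) := by
    intro A
    have hg : ∀ w ∈ F '' A, ∃ u ∈ A, F u = w := fun w hw => hw
    choose! g hgA hFg using hg
    have hlip : LipschitzOnWith 1 (γ ∘ g) (F '' A) := by
      refine LipschitzOnWith.of_dist_le_mul fun w hw z hz => ?_
      have := hdist (g w) (g z)
      rw [hFg w hw, hFg z hz] at this
      simpa using this
    have himg : γ '' A ⊆ (γ ∘ g) '' (F '' A) := by
      rintro _ ⟨u, hu, rfl⟩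
      refine ⟨F u, mem_image_of_mem F hu, ?_⟩
      have := hdist (g (F u)) u
      rw [hFg _ (mem_image_of_mem F hu), dist_self] at this
      exact dist_le_zero.1 this
    refine (measure_mono himg).trans ?_
    simpa [hausdorffMeasure_real] using hlip.hausdorffMeasure_image_le zero_le_one
  have hloc : LocallyIntegrable (fun r => ‖deriv γ r‖) volume := by
    rw [locallyIntegrable_iff]
    intro k hk
    obtain ⟨R, hR⟩ := hk.isBounded.subset_closedBall 0
    rw [Real.closedBall_eq_Icc] at hR
    refine IntegrableOn.mono_set ?_ hR
    by_cases h : (0 : ℝ) - R ≤ 0 + R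
    · exact (intervalIntegrable_iff_integrableOn_Icc_of_le h).1 (hii _ _)
    · rw [Icc_eq_empty h]; exact integrableOn_empty
  have hae : ∀ᵐ t, HasDerivAt F ‖deriv γ t‖ t := by
    filter_upwards [LocallyIntegrable.ae_hasDerivAt_integral hloc] with t ht using ht 0
  obtain ⟨N, hNsub, hNmeas, hNnull⟩ := exists_measurable_superset_of_null (ae_iff.1 hae)
  have hgood : ∀ t ∈ s \ N, HasDerivWithinAt F ‖deriv γ t‖ (s \ N) t := by
    intro t ht
    by_contra h
    exact ht.2 (hNsub fun h' => h h'.hasDerivWithinAt)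
  -- The Lipschitz function `F` maps the null set of bad times to a null set.
  have hbad : volume (F '' N) = 0 := by
    have := hFlip.hausdorffMeasure_image_le zero_le_one N
    rw [hausdorffMeasure_real, hNnull, mul_zero] at this
    exact le_antisymm this (zero_le)
  calc μH[1] (γ '' s) ≤ volume (F '' s) := hle s
    _ ≤ volume (F '' (s \ N) ∪ F '' N) := by
        rw [← image_union]
        exact measure_mono (image_mono fun t ht => by by_cases h : t ∈ N <;> simp [h, ht])
    _ ≤ volume (F '' (s \ N)) + volume (F '' N) := measure_union_le _ _
    _ = ∫⁻ t in s \ N, ENNReal.ofReal ‖deriv γ t‖ := by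
        rw [hbad, add_zero, lintegral_deriv_eq_volume_image_of_monotoneOn (hs.diff hNmeas) hgood
          (hmono.monotoneOn _)]
    _ ≤ ∫⁻ t in s, ENNReal.ofReal ‖deriv γ t‖ := lintegral_mono_set sdiff_subset
    _ = ∫⁻ t in s, ‖deriv γ t‖ₑ := by simp only [ofReal_norm]

/-- The integral over the image of a Lipschitz path is at most the weighted path length. -/
theorem setLIntegral_image_le {L : ℝ≥0} {γ : ℝ → E} (hγ : LipschitzOnWith L γ (Icc 0 1))
    {f : E → ℝ≥0∞} (hf : Measurable f) :
    ∫⁻ z in γ '' Icc 0 1, f z ∂μH[1] ≤ ∫⁻ t in Icc (0 : ℝ) 1, f (γ t) * ‖deriv γ t‖ₑ := by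
  -- Clamping time makes the path Lipschitz on all of `ℝ` and keeps the derivative on the open
  -- interval, which is enough almost everywhere.
  set g : ℝ → E := fun t => γ (projIcc 0 1 zero_le_one t) with hg
  have hgl : LipschitzWith L g := by
    have := (hγ.to_restrict).comp (LipschitzWith.projIcc (zero_le_one (α := ℝ)))
    rwa [mul_one] at this
  have heq : ∀ t ∈ Icc (0 : ℝ) 1, g t = γ t := fun t ht => by
    simp [hg, projIcc_of_mem zero_le_one ht]
  have himg : γ '' Icc 0 1 = g '' Icc 0 1 := image_congr fun t ht => (heq t ht).symm
  have hrhs : ∫⁻ t in Icc (0 : ℝ) 1, f (γ t) * ‖deriv γ t‖ₑ =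
      ∫⁻ t in Icc (0 : ℝ) 1, f (g t) * ‖deriv g t‖ₑ := by
    rw [restrict_congr_set Ioo_ae_eq_Icc.symm]
    refine setLIntegral_congr_fun measurableSet_Ioo fun t ht => ?_
    have : g =ᶠ[𝓝 t] γ := by
      filter_upwards [Icc_mem_nhds ht.1 ht.2] with u hu using heq u hu
    simp only [this.deriv_eq, this.eq_of_nhds]
  rw [himg, hrhs]
  have hd : Measurable fun t => ‖deriv g t‖ₑ := (measurable_deriv g).enorm
  have hgm : Measurable g := hgl.continuous.measurable
  have hle : μH[1].restrict (g '' Icc 0 1) ≤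
      ((volume.restrict (Icc 0 1)).withDensity fun t => ‖deriv g t‖ₑ).map g := by
    refine Measure.le_iff.2 fun B hB => ?_
    rw [restrict_apply hB, map_apply hgm hB, withDensity_apply _ (hgm hB),
      restrict_restrict (hgm hB), inter_comm, ← image_inter_preimage, inter_comm]
    exact hausdorffMeasure_image_le_lintegral hgl ((hgm hB).inter measurableSet_Icc)
  refine (lintegral_mono' hle le_rfl).trans_eq ?_
  rw [lintegral_map hf hgm]
  refine (lintegral_withDensity_eq_lintegral_mul _ hd (hf.comp hgm)).trans ?_
  refine lintegral_congr fun t => ?_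
  simp [mul_comm]

end AreaInequality

/-! ### Lower semicontinuity of the image integral. -/

section Semicontinuity

/-- Layer cake formula for functions with values in `[0,∞]`. -/
theorem lintegral_eq_lintegral_measure_lt {X : Type*} [MeasurableSpace X] (μ : Measure X)
    [SFinite μ] {f : X → ℝ≥0∞} (hf : Measurable f) :
    ∫⁻ z, f z ∂μ = ∫⁻ r in Ioi (0 : ℝ), μ {z | ENNReal.ofReal r < f z} := by
  have hm : MeasurableSet {p : X × ℝ | ENNReal.ofReal p.2 < f p.1} :=
    measurableSet_lt (ENNReal.measurable_ofReal.comp measurable_snd) (hf.comp measurable_fst)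
  -- Each value, `∞` included, is the length of the interval of positive reals below it; the rest is
  -- Tonelli.
  have hval : ∀ c : ℝ≥0∞, c = volume.restrict (Ioi (0 : ℝ)) {r | ENNReal.ofReal r < c} := by
    intro c
    rw [restrict_apply (measurableSet_lt ENNReal.measurable_ofReal measurable_const)]
    induction c with
    | top => simp
    | coe c =>
      have : {r : ℝ | ENNReal.ofReal r < c} ∩ Ioi 0 = Ioo 0 (c : ℝ) := by
        ext r
        simp only [mem_inter_iff, mem_ofPred_eq, mem_Ioi, mem_Ioo]
        refine ⟨fun h => ⟨h.2, ?_⟩, fun h => ⟨?_, h.1⟩⟩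
        · have := h.1
          rw [← ENNReal.ofReal_coe_nnreal] at this
          exact ((ENNReal.ofReal_lt_ofReal_iff_of_nonneg h.2.le).1 this)
        · rw [← ENNReal.ofReal_coe_nnreal]
          exact (ENNReal.ofReal_lt_ofReal_iff_of_nonneg h.1.le).2 h.2
      rw [this, Real.volume_Ioo, sub_zero, ENNReal.ofReal_coe_nnreal]
  calc ∫⁻ z, f z ∂μ = ∫⁻ z, volume.restrict (Ioi (0 : ℝ)) {r | ENNReal.ofReal r < f z} ∂μ :=
        lintegral_congr fun z => hval _
    _ = (μ.prod (volume.restrict (Ioi (0 : ℝ)))) {p | ENNReal.ofReal p.2 < f p.1} :=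
        (Measure.prod_apply hm).symm
    _ = _ := Measure.prod_apply_symm hm

variable {X : Type*} [MetricSpace X] [MeasurableSpace X] [BorelSpace X]

/-- For the arcs `ψ k` the measure in `U` equals `l k` times the time spent in `U`; for the limit,
which need not be an arc, only `≤` is needed. A time at which `g` lies in the open set `U` is
eventually such a time for `ψ k`, so Fatou's lemma applies. -/
theorem hausdorffMeasure_image_inter_le_liminf {ψ : ℕ → ℝ → X} {l : ℕ → ℝ≥0} {g : ℝ → X} {m : ℝ≥0}
    (hψ : ∀ k, LipschitzOnWith (l k) (ψ k) (Icc 0 1))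
    (hl : ∀ k, μH[1] (ψ k '' Icc 0 1) = l k) (hg : LipschitzOnWith m g (Icc 0 1))
    (hlm : Tendsto l atTop (𝓝 m))
    (hlim : ∀ t ∈ Icc (0 : ℝ) 1, Tendsto (fun k => ψ k t) atTop (𝓝 (g t)))
    {U : Set X} (hU : IsOpen U) :
    μH[1] (U ∩ g '' Icc 0 1) ≤ liminf (fun k => μH[1] (U ∩ ψ k '' Icc 0 1)) atTop := by
  set f : X → ℝ≥0∞ := U.indicator 1 with hf
  have hfm : Measurable f := measurable_one.indicator hU.measurableSet
  have hgm : AEMeasurable g (volume.restrict (Icc 0 1)) :=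
    hg.continuousOn.aemeasurable measurableSet_Icc
  have hψm : ∀ k, AEMeasurable (ψ k) (volume.restrict (Icc 0 1)) := fun k =>
    (hψ k).continuousOn.aemeasurable measurableSet_Icc
  have h1 : μH[1] (U ∩ g '' Icc 0 1) ≤ ∫⁻ t in Icc (0 : ℝ) 1, m * f (g t) := by
    rw [lintegral_const_mul'' _ (hfm.comp_aemeasurable' hgm)]
    have : ∫⁻ t in Icc (0 : ℝ) 1, f (g t) = volume (Icc 0 1 ∩ g ⁻¹' U) := by
      have e : (fun t => f (g t)) = (g ⁻¹' U).indicator 1 := by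
        ext t; rfl
      rw [e, lintegral_indicator_one₀ (hgm.nullMeasurable hU.measurableSet),
        restrict_apply' measurableSet_Icc, inter_comm]
    rw [this, inter_comm, ← image_inter_preimage]
    exact hausdorffMeasure_image_le_mul_volume (hg.mono inter_subset_left)
  have h2 : ∀ k, μH[1] (U ∩ ψ k '' Icc 0 1) = ∫⁻ t in Icc (0 : ℝ) 1, l k * f (ψ k t) := by
    intro k
    rw [lintegral_const_mul'' _ (hfm.comp_aemeasurable' (hψm k)),
      ← setLIntegral_image_eq (hψ k) (hl k) hfm, lintegral_indicator_one hU.measurableSet,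
      restrict_apply hU.measurableSet]
  simp only [h2]
  refine h1.trans (le_trans (setLIntegral_mono_ae' measurableSet_Icc ?_) (lintegral_liminf_le'
    fun k => (hfm.comp_aemeasurable (hψm k)).const_mul _))
  refine Eventually.of_forall fun t ht => ?_
  by_cases htU : g t ∈ U
  · have hev : (fun k => (l k : ℝ≥0∞) * f (ψ k t)) =ᶠ[atTop] fun k => (l k : ℝ≥0∞) := by
      filter_upwards [(hlim t ht).eventually (hU.mem_nhds htU)] with k hk
      rw [hf, indicator_of_mem hk, Pi.one_apply, mul_one]
    rw [liminf_congr hev, ((ENNReal.tendsto_coe.2 hlm).liminf_eq)]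
    simp [hf, htU]
  · simp [hf, htU]

/-- Lower semicontinuity of the integral over the image along paths parametrized proportionally to
arc length; only the finiteness of the measure of sublevel sets of the integrand is needed. -/
theorem setLIntegral_image_le_liminf {ψ : ℕ → ℝ → X} {l : ℕ → ℝ≥0} {g : ℝ → X} {m : ℝ≥0}
    (hψ : ∀ k, LipschitzOnWith (l k) (ψ k) (Icc 0 1))
    (hl : ∀ k, μH[1] (ψ k '' Icc 0 1) = l k) (hg : LipschitzOnWith m g (Icc 0 1))
    (hlm : Tendsto l atTop (𝓝 m))
    (hlim : ∀ t ∈ Icc (0 : ℝ) 1, Tendsto (fun k => ψ k t) atTop (𝓝 (g t)))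
    {f : X → ℝ≥0∞} (hf : Measurable f)
    (hfin : ∀ r : ℝ≥0∞, r ≠ ∞ → (∀ z, f z ≤ r) ∨ μH[1] {z | f z ≤ r} < ∞) :
    ∫⁻ z in g '' Icc 0 1, f z ∂μH[1] ≤
      liminf (fun k => ∫⁻ z in ψ k '' Icc 0 1, f z ∂μH[1]) atTop := by
  have hsfin : ∀ {c : ℝ≥0} {h : ℝ → X}, LipschitzOnWith c h (Icc 0 1) →
      IsFiniteMeasure (μH[1].restrict (h '' Icc 0 1)) := fun {c h} hh =>
    ⟨by rw [restrict_apply_univ]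
        exact (hausdorffMeasure_image_Icc_le hh).trans_lt ENNReal.coe_lt_top⟩
  have := hsfin hg
  have := fun k => hsfin (hψ k)
  have hfm : ∀ r : ℝ≥0∞, MeasurableSet {z | r < f z} := fun r =>
    measurableSet_lt measurable_const hf
  rw [lintegral_eq_lintegral_measure_lt _ hf]
  simp only [fun k => lintegral_eq_lintegral_measure_lt (μH[1].restrict (ψ k '' Icc 0 1)) hf]
  refine le_trans (lintegral_mono fun r => ?_) (lintegral_liminf_le fun k => ?_)
  swap
  · have hm : Antitone fun r : ℝ =>
        μH[1].restrict (ψ k '' Icc 0 1) {z | ENNReal.ofReal r < f z} := fun r s hrs =>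
      measure_mono fun z hz => (ENNReal.ofReal_le_ofReal hrs).trans_lt hz
    exact hm.measurable
  simp only [restrict_apply (hfm _)]
  rcases hfin (ENNReal.ofReal r) ENNReal.ofReal_ne_top with h | h
  · have : {z | ENNReal.ofReal r < f z} = ∅ := by
      ext z; simpa using h z
    simp [this]
  · set T := {z | f z ≤ ENNReal.ofReal r} with hT
    have hTm : MeasurableSet T := measurableSet_le hf measurable_const
    have hcompl : {z | ENNReal.ofReal r < f z} = Tᶜ := by ext z; simp [hT]
    rw [hcompl]
    -- Replace `T` by a closed subset `K` with `μH[1] (T \ K) ≤ ε`: then `Kᶜ` is open, and the error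
    -- is at most `ε` on every image, uniformly in `k`.
    refine ENNReal.le_of_forall_pos_le_add fun ε hε _ => ?_
    have : IsFiniteMeasure (μH[1].restrict T) := ⟨by rwa [restrict_apply_univ]⟩
    obtain ⟨K, hKT, hK, hKlt⟩ := hTm.exists_isClosed_sdiff_lt (μ := μH[1].restrict T)
      (measure_ne_top _ _) (ENNReal.coe_ne_zero.2 hε.ne')
    have hdiff : μH[1] (T \ K) ≤ ε := by
      rw [restrict_apply (hTm.diff hK.measurableSet),
        inter_eq_left.2 sdiff_subset] at hKlt
      exact hKlt.le
    calc μH[1] (Tᶜ ∩ g '' Icc 0 1) ≤ μH[1] (Kᶜ ∩ g '' Icc 0 1) :=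
          measure_mono (inter_subset_inter_left _ (compl_subset_compl.2 hKT))
      _ ≤ liminf (fun k => μH[1] (Kᶜ ∩ ψ k '' Icc 0 1)) atTop :=
          hausdorffMeasure_image_inter_le_liminf hψ hl hg hlm hlim hK.isOpen_compl
      _ ≤ liminf (fun k => μH[1] (Tᶜ ∩ ψ k '' Icc 0 1) + ε) atTop := by
          refine liminf_le_liminf (Eventually.of_forall fun k => ?_)
          calc μH[1] (Kᶜ ∩ ψ k '' Icc 0 1)
              ≤ μH[1] ((Tᶜ ∩ ψ k '' Icc 0 1) ∪ (T \ K)) := by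
                refine measure_mono fun z hz => ?_
                by_cases h : z ∈ T
                · exact Or.inr ⟨h, hz.1⟩
                · exact Or.inl ⟨h, hz.2⟩
            _ ≤ _ := (measure_union_le _ _).trans (add_le_add_right hdiff _)
      _ = liminf (fun k => μH[1] (Tᶜ ∩ ψ k '' Icc 0 1)) atTop + ε :=
          liminf_add_const _ _ _ (by isBoundedDefault) (by isBoundedDefault)

end Semicontinuity

/-! ### The cube, the extended friction coefficient and the length bound. -/

section Friction

variable {n : ℕ} {S : Set (EuclideanSpace ℝ (Fin n))} {a : ℝ≥0∞} {b : S → ℝ≥0∞}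

theorem isCompact_cube (n : ℕ) : IsCompact (cube n) := by
  have h : cube n = ⋂ i, {x | x i ∈ Icc (-1 : ℝ) 1} := by ext x; simp [cube]
  refine Metric.isCompact_of_isClosed_isBounded ?_ ?_
  · rw [h]
    exact isClosed_iInter fun i =>
      isClosed_Icc.preimage (EuclideanSpace.proj (𝕜 := ℝ) i).continuous
  · refine (Metric.isBounded_iff_subset_closedBall 0).2 ⟨√n, fun x hx => ?_⟩
    rw [mem_closedBall_zero_iff, EuclideanSpace.norm_eq]
    refine Real.sqrt_le_sqrt ?_
    refine (Finset.sum_le_card_nsmul _ _ 1 fun i _ => ?_).trans (by simp)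
    have := hx i
    rw [Real.norm_eq_abs, sq_abs]
    nlinarith [this.1, this.2]

theorem measurable_friction (hS : MeasurableSet S) (hb : LowerSemicontinuous b) :
    Measurable (friction S a b) := by
  refine measurable_of_restrict_of_restrict_compl hS ?_ ?_
  · have : S.domRestrict (friction S a b) = b := by ext z; simp [friction]
    rw [this]
    exact hb.measurable
  · have : Sᶜ.domRestrict (friction S a b) = fun _ => a := by
      ext z
      have : (z : EuclideanSpace ℝ (Fin n)) ∉ S := z.2
      simp [friction, this]
    rw [this]
    exact measurable_const

theorem friction_le (hba : ∀ z, b z ≤ a) (z : EuclideanSpace ℝ (Fin n)) :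
    friction S a b z ≤ a := by
  unfold friction
  split_ifs with h
  · exact hba _
  · exact le_rfl

/-- Off `S` the friction is `a > r`, so no point outside the network enters. -/
theorem setOf_friction_le {r : ℝ≥0∞} (hr : r < a) : {z | friction S a b z ≤ r} = sublevel S b r := by
  ext z
  simp only [friction, sublevel, mem_ofPred_eq]
  by_cases h : z ∈ S
  · simp [h]
  · simp [h, hr]

/-- The length of a path is controlled by the good part of the network and the cost. -/
theorem hausdorffMeasure_image_le_add {r : ℝ≥0∞} (hr0 : r ≠ 0) (hr : r < a)
    (hf : Measurable (friction S a b)) (A : Set (EuclideanSpace ℝ (Fin n))) :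
    μH[1] A ≤ μH[1] (sublevel S b r) + r⁻¹ * ∫⁻ z in A, friction S a b z ∂μH[1] := by
  have hm : MeasurableSet {z | r < friction S a b z} := measurableSet_lt measurable_const hf
  have h1 : A ⊆ sublevel S b r ∪ ({z | r < friction S a b z} ∩ A) := by
    intro z hz
    rw [← setOf_friction_le hr]
    rcases le_or_gt (friction S a b z) r with h | h
    · exact Or.inl h
    · exact Or.inr ⟨h, hz⟩
  refine (measure_mono h1).trans ((measure_union_le _ _).trans ?_)
  gcongr
  -- Markov's inequality bounds the part of `A` where the friction exceeds `r`.
  have h2 : r * μH[1].restrict A {z | r ≤ friction S a b z} ≤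
      ∫⁻ z in A, friction S a b z ∂μH[1] := mul_meas_ge_le_lintegral hf r
  rw [mul_comm, ← div_eq_mul_inv, ENNReal.le_div_iff_mul_le (Or.inl hr0) (Or.inl hr.ne_top),
    mul_comm]
  refine le_trans ?_ h2
  rw [← restrict_apply hm]
  gcongr
  exact fun h => le_of_lt h

end Friction

/-! ### Comparison of the functionals and existence of an optimal path. -/

section Minimizer

variable {n : ℕ} {S : Set (EuclideanSpace ℝ (Fin n))} {a : ℝ≥0∞} {b : S → ℝ≥0∞}
  {x y : EuclideanSpace ℝ (Fin n)}

theorem urbanDist_le_pathLength (hf : Measurable (friction S a b))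
    {γ : ℝ → EuclideanSpace ℝ (Fin n)} (hγ : γ ∈ paths x y) :
    urbanDist S a b x y ≤ pathLength S a b γ := by
  obtain ⟨K, hK⟩ := hγ.1
  exact (iInf₂_le γ hγ).trans (setLIntegral_image_le hK hf)

theorem ae_enorm_deriv_le {E : Type*} [NormedAddCommGroup E] [NormedSpace ℝ E] {l : ℝ≥0}
    {ψ : ℝ → E} (hψ : LipschitzOnWith l ψ (Icc 0 1)) :
    ∀ᵐ t ∂volume.restrict (Icc (0 : ℝ) 1), ‖deriv ψ t‖ₑ ≤ l := by
  rw [restrict_congr_set Ioo_ae_eq_Icc.symm]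
  refine (ae_restrict_iff' measurableSet_Ioo).2 (Eventually.of_forall fun t ht => ?_)
  rw [enorm_eq_nnnorm, ENNReal.coe_le_coe]
  exact norm_deriv_le_of_lipschitzOn (Icc_mem_nhds ht.1 ht.2) hψ

theorem arcLength_le {l : ℝ≥0} {ψ : ℝ → EuclideanSpace ℝ (Fin n)}
    (hψ : LipschitzOnWith l ψ (Icc 0 1)) : arcLength ψ ≤ l := by
  unfold arcLength
  refine (lintegral_mono_ae (ae_enorm_deriv_le hψ)).trans ?_
  simp

/-- The speed is at most `l`, while the image integral is exactly `l` times the time integral of the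
friction. -/
theorem pathLength_le {l : ℝ≥0} {ψ : ℝ → EuclideanSpace ℝ (Fin n)}
    (hψ : LipschitzOnWith l ψ (Icc 0 1)) (hl : μH[1] (ψ '' Icc 0 1) = l)
    (hf : Measurable (friction S a b)) :
    pathLength S a b ψ ≤ ∫⁻ z in ψ '' Icc 0 1, friction S a b z ∂μH[1] := by
  rw [setLIntegral_image_eq hψ hl hf, ← lintegral_const_mul' _ _ ENNReal.coe_ne_top]
  refine lintegral_mono_ae ?_
  filter_upwards [ae_enorm_deriv_le hψ] with t ht
  rw [mul_comm]
  gcongr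

/-- If `0 < a`, then the infimum defining the urban metric is attained. -/
theorem exists_setLIntegral_eq_urbanDist (ha : 0 < a) (hne : x ≠ y)
    (hf : Measurable (friction S a b)) (hba : ∀ z, b z ≤ a)
    (hfin : ∀ l : ℝ≥0∞, l < a → μH[1] (sublevel S b l) < ∞)
    (hd : urbanDist S a b x y < ∞) :
    ∃ γ ∈ paths x y, ∫⁻ z in γ '' Icc 0 1, friction S a b z ∂μH[1] ≤ urbanDist S a b x y := by
  obtain ⟨r, hr0, hra⟩ := exists_between ha
  set d := urbanDist S a b x y with hdd
  have hseq : ∀ k : ℕ, ∃ (ψ : ℝ → EuclideanSpace ℝ (Fin n)) (l : ℝ≥0),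
      LipschitzOnWith l ψ (Icc 0 1) ∧ MapsTo ψ (Icc 0 1) (cube n) ∧ ψ 0 = x ∧ ψ 1 = y ∧
      μH[1] (ψ '' Icc 0 1) = l ∧
      ∫⁻ z in ψ '' Icc 0 1, friction S a b z ∂μH[1] ≤ d + ((k : ℝ≥0∞) + 1)⁻¹ := by
    intro k
    have hlt : d < d + ((k : ℝ≥0∞) + 1)⁻¹ :=
      ENNReal.lt_add_right hd.ne (ENNReal.inv_ne_zero.2 (by finiteness))
    conv_lhs at hlt => rw [hdd]
    unfold urbanDist at hlt
    simp only [iInf_lt_iff] at hlt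
    obtain ⟨γ, ⟨⟨K, hK⟩, hm, h0, h1⟩, hγ⟩ := hlt
    obtain ⟨ψ, l, hψ, hψm, hψ0, hψ1, -, hl⟩ := exists_arc hK (by rwa [h0, h1])
    exact ⟨ψ, l, hψ, hψm.mono_right hm.image_subset, hψ0.trans h0, hψ1.trans h1, hl,
      (lintegral_mono_set hψm.image_subset).trans hγ.le⟩
  choose ψ l hψ hm h0 h1 hl hint using hseq
  -- A bound on all arc lengths; the `1` absorbs the error `1 / (k + 1)` of the minimizing sequence.
  set M : ℝ≥0∞ := μH[1] (sublevel S b r) + r⁻¹ * (d + 1) with hM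
  have hMtop : M ≠ ∞ := by
    refine ENNReal.add_ne_top.2 ⟨(hfin r hra).ne, ENNReal.mul_ne_top ?_ ?_⟩
    · exact ENNReal.inv_ne_top.2 hr0.ne'
    · exact ENNReal.add_ne_top.2 ⟨hd.ne, ENNReal.one_ne_top⟩
  have hlM : ∀ k, l k ∈ Icc 0 M.toNNReal := by
    refine fun k => ⟨zero_le, ?_⟩
    rw [← ENNReal.coe_le_coe, ENNReal.coe_toNNReal hMtop, ← hl k]
    refine (hausdorffMeasure_image_le_add hr0.ne' hra hf _).trans ?_
    rw [hM]
    gcongr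
    refine (hint k).trans ?_
    gcongr
    exact ENNReal.inv_le_one.2 le_add_self
  -- The lengths must converge too: the semicontinuity argument compares `m` with the limit of the
  -- `l k`.
  obtain ⟨m, -, φ₁, hφ₁, hlim₁⟩ := isCompact_Icc.tendsto_subseq hlM
  obtain ⟨g, φ₂, hφ₂, hg, hlim⟩ := exists_subseq_tendsto_of_lipschitzOnWith (isCompact_cube n)
    (L := M.toNNReal) (fun k => (hψ (φ₁ k)).weaken (hlM _).2) (fun k => hm (φ₁ k))
  have hlim₂ : Tendsto (fun k => l (φ₁ (φ₂ k))) atTop (𝓝 m) := hlim₁.comp hφ₂.tendsto_atTop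
  have hgl : LipschitzOnWith m g (Icc 0 1) :=
    lipschitzOnWith_of_tendsto (fun k => hψ (φ₁ (φ₂ k))) hlim₂ hlim
  refine ⟨g, ⟨⟨m, hgl⟩, hg, ?_, ?_⟩, ?_⟩
  · have := hlim 0 (by simp)
    simp only [h0] at this
    exact tendsto_nhds_unique this tendsto_const_nhds
  · have := hlim 1 (by simp)
    simp only [h1] at this
    exact tendsto_nhds_unique this tendsto_const_nhds
  refine (setLIntegral_image_le_liminf (fun k => hψ (φ₁ (φ₂ k))) (fun k => hl _) hgl hlim₂ hlim hf
    fun r _ => ?_).trans ?_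
  · rcases lt_or_ge r a with h | h
    · exact Or.inr ((setOf_friction_le h).symm ▸ hfin r h)
    · exact Or.inl fun z => (friction_le hba z).trans h
  · have ht : Tendsto (fun k : ℕ => d + ((k : ℝ≥0∞) + 1)⁻¹) atTop (𝓝 d) := by
      have : Tendsto (fun k : ℕ => ((k : ℝ≥0∞) + 1)⁻¹) atTop (𝓝 0) := by
        simpa using (tendsto_add_atTop_iff_nat 1).2 ENNReal.tendsto_inv_nat_nhds_zero
      simpa using this.const_add d
    have ht' := ht.comp (hφ₁.comp hφ₂).tendsto_atTop
    refine le_trans (liminf_le_liminf (Eventually.of_forall fun k => hint (φ₁ (φ₂ k)))) ?_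
    exact ht'.liminf_eq.le

end Minimizer

end UrbanMetric

/-! ### The proposition. -/

open UrbanMetric

theorem mainTheorem6 (n : ℕ) (S : Set (EuclideanSpace ℝ (Fin n))) (a : ℝ≥0∞) (b : S → ℝ≥0∞)
    (hSC : S ⊆ UrbanMetric.cube n) (hSrect : UrbanMetric.CountablyOneRectifiable S)
    (hSmeas : MeasurableSet S) (hblsc : LowerSemicontinuous b) (hba : ∀ z, b z ≤ a)
    (hfin : ∀ l : ℝ≥0∞, l < a → μH[1] (UrbanMetric.sublevel S b l) < ∞)
    (x y : EuclideanSpace ℝ (Fin n)) (hx : x ∈ UrbanMetric.cube n) (hy : y ∈ UrbanMetric.cube n)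
    (hd : UrbanMetric.urbanDist S a b x y < ∞) :
    ∃ ψ ∈ UrbanMetric.paths x y,
      UrbanMetric.pathLength S a b ψ = UrbanMetric.urbanDist S a b x y ∧
      (∀ γ ∈ UrbanMetric.paths x y,
        UrbanMetric.pathLength S a b ψ ≤ UrbanMetric.pathLength S a b γ) ∧
      (x ≠ y → InjOn ψ (Icc 0 1)) ∧
      (a = ∞ → UrbanMetric.arcLength ψ ≤
        μH[1] (UrbanMetric.sublevel S b 1) + UrbanMetric.urbanDist S a b x y) ∧
      (0 < a → a < ∞ → UrbanMetric.arcLength ψ ≤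
        μH[1] (UrbanMetric.sublevel S b (a / 2)) + 2 / a * UrbanMetric.urbanDist S a b x y) := by
  have hf : Measurable (friction S a b) := measurable_friction hSmeas hblsc
  by_cases hxy : x = y
  · subst hxy
    have hc : (fun _ => x) ∈ paths x x :=
      ⟨⟨0, (LipschitzWith.const x).lipschitzOnWith⟩, fun _ _ => hx, rfl, rfl⟩
    have h0 : pathLength S a b (fun _ => x) = 0 := by simp [pathLength]
    have hd0 : urbanDist S a b x x = 0 :=
      le_antisymm (h0 ▸ urbanDist_le_pathLength hf hc) zero_le
    have ha0 : arcLength (fun _ : ℝ => x) = 0 := by simp [arcLength]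
    refine ⟨fun _ => x, hc, h0.trans hd0.symm, fun γ _ => h0 ▸ zero_le, fun h => absurd rfl h,
      fun _ => ha0 ▸ zero_le, fun _ _ => ha0 ▸ zero_le⟩
  obtain ⟨γ, ⟨⟨K, hK⟩, hm, h0, h1⟩, hγ⟩ : ∃ γ ∈ paths x y,
      ∫⁻ z in γ '' Icc 0 1, friction S a b z ∂μH[1] ≤ urbanDist S a b x y := by
    rcases eq_or_ne a 0 with rfl | ha
    -- For `a = 0` every path costs nothing, and one exists because an infimum over no paths would
    -- be `∞`.
    · have hne : (paths x y).Nonempty := by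
        by_contra h
        rw [not_nonempty_iff_eq_empty] at h
        simp [urbanDist, h] at hd
      obtain ⟨γ, hγ⟩ := hne
      refine ⟨γ, hγ, ?_⟩
      have : ∀ z, friction S 0 b z = 0 := fun z => le_antisymm (friction_le hba z) zero_le
      simp [this]
    · exact exists_setLIntegral_eq_urbanDist (pos_iff_ne_zero.2 ha) hxy hf hba hfin hd
  -- The optimal path may have loops; an arc inside its image costs no more and is injective of
  -- constant speed.
  obtain ⟨ψ, l, hψ, hψm, hψ0, hψ1, hinj, hl⟩ := exists_arc hK (by rwa [h0, h1])
  have hψp : ψ ∈ paths x y :=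
    ⟨⟨l, hψ⟩, hψm.mono_right hm.image_subset, hψ0.trans h0, hψ1.trans h1⟩
  have hint : ∫⁻ z in ψ '' Icc 0 1, friction S a b z ∂μH[1] ≤ urbanDist S a b x y :=
    (lintegral_mono_set hψm.image_subset).trans hγ
  have hle : pathLength S a b ψ ≤ urbanDist S a b x y := (pathLength_le hψ hl hf).trans hint
  have hlen : ∀ r, r ≠ 0 → r < a →
      arcLength ψ ≤ μH[1] (sublevel S b r) + r⁻¹ * urbanDist S a b x y := by
    intro r hr0 hr
    refine (arcLength_le hψ).trans (hl ▸ (hausdorffMeasure_image_le_add hr0 hr hf _).trans ?_)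
    gcongr
  refine ⟨ψ, hψp, le_antisymm hle (urbanDist_le_pathLength hf hψp),
    fun γ' hγ' => hle.trans (urbanDist_le_pathLength hf hγ'), fun _ => hinj, fun ha => ?_,
    fun ha0 ha => ?_⟩
  · simpa using hlen 1 one_ne_zero (ha ▸ ENNReal.one_lt_top)
  · have := hlen (a / 2) (ENNReal.div_pos ha0.ne' ENNReal.ofNat_ne_top).ne'
      (ENNReal.half_lt_self ha0.ne' ha.ne)
    rwa [ENNReal.inv_div (Or.inl ENNReal.ofNat_ne_top) (Or.inl two_ne_zero)] at this
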